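/- **Theorem 4.2.** Let $n\ge 4$ be even, let $\alpha_4,\dots,\alpha_n,\theta\in\mathbb C$, and let $L$ be the $n$-dimensional complex (right) Leibniz algebra $F_1(\alpha_4,\dots,\alpha_n,\theta)$, i.e. $L$ has a basis $e_1,\dots,e_n$ with $$[e_1,e_1]=e_3,\qquad [e_i,e_1]=e_{i+1}\ (2\le i\le n-1),\qquad [e_1,e_2]=\sum_{t=4}^{n-1}\alpha_t e_t+\theta e_n,\qquad [e_j,e_2]=\sum_{t=j+2}^{n}\alpha_{t-j+2}\,e_t\ (2\le j\le n-2),$$ all other products of basis vectors being zero. A pre-derivation of $L$ is a linear map $P:L\to L$ with $P([[x,y],z])=[[P(x),y],z]+[[x,P(y)],z]+[[x,y],P(z)]$ for all $x,y,z\in L$, and $L$ is called strongly nilpotent if every pre-derivation of $L$ is nilpotent. Let $C^p_m=\frac{1}{(p-1)m+1}\binom{pm}{m}$ denote the $p$-th Catalan numbers. Then $L$ is non-strongly nilpotent (that is, it has a non-nilpotent pre-derivation) if and only if at least one of the following holds: (i) $\alpha_4\ne 0$ and $\alpha_k=(-1)^k\,C^2_{k-3}\,\alpha_4^{\,k-3}$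 for $5\le k\le n-2$; (ii) there is an integer $s$ with $3\le s\le \frac{n-2}{2}$ such that $\alpha_{(2s-3)t+3}=(-1)^{t+1}\,C^{2s-2}_t\,\alpha_{2s}^{\,t}$ for all $1\le t\le\left\lfloor\frac{n-5}{2s-3}\right\rfloor$, and $\alpha_j=0$ for every $4\le j\le n-2$ that is not of the form $(2s-3)t+3$ with $t\ge 1$; (iii) $\alpha_{2i}=0$ for all $2\le i\le\frac{n-2}{2}$. -/

import Mathlib

open Finset

/-- A (right) Leibniz algebra over `K`: a bilinear bracket satisfying
`[[x, y], z] = [[x, z], y] + [x, [y, z]]`. -/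
class LeibnizAlgebra (K L : Type*) [Field K] [AddCommGroup L] [Module K L] where
  /-- The bilinear bracket. -/
  bracket : L →ₗ[K] L →ₗ[K] L
  leibniz : ∀ x y z : L,
    bracket (bracket x y) z = bracket (bracket x z) y + bracket x (bracket y z)

namespace LeibnizAlgebra

variable (K : Type*) {L : Type*} [Field K] [AddCommGroup L] [Module K L] [LeibnizAlgebra K L]

/-- The bracket `[x, y]`. -/
def br (x y : L) : L := bracket (K := K) x y

/-- A linear map `P` with `P [[x, y], z] = [[P x, y], z] + [[x, P y], z] + [[x, y], P z]`. -/
def IsPreDerivation (P : Module.End K L) : Prop :=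
  ∀ x y z : L, P (br K (br K x y) z) =
    br K (br K (P x) y) z + br K (br K x (P y)) z + br K (br K x y) (P z)

variable (L) in
/-- Every pre-derivation is nilpotent. -/
def IsStronglyNilpotent : Prop :=
  ∀ P : Module.End K L, IsPreDerivation K P → IsNilpotent P

variable {K}

/-- The basis vectors `e₁, …, eₙ`, numbered from `1`; `basisVec b i` is `0` for `i` outside
`{1, …, n}`. -/
noncomputable def basisVec {n : ℕ} (b : Module.Basis (Fin n) K L) (i : ℕ) : L :=
  if h : 1 ≤ i ∧ i ≤ n then b ⟨i - 1, by omega⟩ else 0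

/-- The basis `e₁, …, eₙ` (with `n ≥ 4`) has the multiplication table of
`F₁(α₄, …, αₙ, θ)`. Only the values `α 4, …, α n` of `α` occur. -/
structure IsF1Basis {n : ℕ} (α : ℕ → K) (θ : K) (b : Module.Basis (Fin n) K L) : Prop where
  /-- `[e₁, e₁] = e₃` -/
  one_one : br K (basisVec b 1) (basisVec b 1) = basisVec b 3
  /-- `[eᵢ, e₁] = eᵢ₊₁` for `2 ≤ i ≤ n - 1` -/
  mul_one : ∀ i, 2 ≤ i → i ≤ n - 1 →
    br K (basisVec b i) (basisVec b 1) = basisVec b (i + 1)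
  /-- `[e₁, e₂] = α₄ e₄ + ⋯ + αₙ₋₁ eₙ₋₁ + θ eₙ` -/
  one_two : br K (basisVec b 1) (basisVec b 2) =
    ∑ t ∈ Icc 4 (n - 1), α t • basisVec b t + θ • basisVec b n
  /-- `[eⱼ, e₂] = ∑ αₜ₋ⱼ₊₂ eₜ` over `j + 2 ≤ t ≤ n`, for `2 ≤ j ≤ n - 2` -/
  mul_two : ∀ j, 2 ≤ j → j ≤ n - 2 →
    br K (basisVec b j) (basisVec b 2) = ∑ t ∈ Icc (j + 2) n, α (t - j + 2) • basisVec b t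
  /-- The omitted products vanish: `[eₙ, e₁] = 0`, -/
  last_one : br K (basisVec b n) (basisVec b 1) = 0
  /-- `[eₙ₋₁, e₂] = [eₙ, e₂] = 0`, -/
  last_two : ∀ j, n - 1 ≤ j → j ≤ n → br K (basisVec b j) (basisVec b 2) = 0
  /-- and `[eᵢ, eⱼ] = 0` for `j ≥ 3`. -/
  mul_ge_three : ∀ i j, 1 ≤ i → i ≤ n → 3 ≤ j → j ≤ n →
    br K (basisVec b i) (basisVec b j) = 0

variable (L) in
/-- `L` is the `n`-dimensional algebra `F₁(α₄, …, αₙ, θ)`: some basis has its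
multiplication table. -/
def IsF1 (n : ℕ) (α : ℕ → K) (θ : K) : Prop :=
  ∃ b : Module.Basis (Fin n) K L, IsF1Basis α θ b

end LeibnizAlgebra

/-- The `m`-th `p`-th Catalan number `(1 / ((p - 1) m + 1)) * binom (p m) m`. -/
def pCatalan (p m : ℕ) : ℚ :=
  1 / (((p : ℚ) - 1) * m + 1) * (Nat.choose (p * m) m : ℚ)

/-!
Write `Xⁱ` for `eᵢ₊₂`. Then the span of `e₂, …, eₙ` is `K[X] / (X ^ (n - 1))`, on which `e₁` acts
from the right as multiplication by `X` and `e₂` as multiplication by `f = ∑ αₜ Xᵗ⁻²`, while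
`e₁ - e₂` is annihilated by all double right multiplications. A triple product is therefore a
product of three polynomials (`IsF1Basis.br_br`), and a pre-derivation `P` amounts to an operator
`D` on `K[X] / (X ^ (n - 1))` that satisfies a product rule for multiplication by `X²`, `X f` and
`f²`, where `X` and `f` are replaced in turn by the polynomials `h` and `g` by which `P e₁` and
`P e₂` act.

The rule for `X²` determines `D` from `D 1` and `D X`. If the even part of `f` vanishes below
degree `n - 3`, which is condition (iii), the projection onto odd polynomials is a non-nilpotent
solution. Otherwise the rule for `X f` forces `h f' = g` modulo `X ^ (n - 3)`
(`dvd_of_leibniz_X_sq_of_leibniz_X_mul`), and `P` is nilpotent unless, after scaling,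
`h = X + (k - 1) f` and `g = k f`, where `k` is the order of `f` (`IsF1Basis.exists_ode`).
Conversely, a solution of `(X + (k - 1) f) f' = k f` modulo `X ^ (n - 3)` with `k` even gives the
operator `h p' + k p + ν p(-X)`, the last term compensating the error in the top degree
(`IsF1Basis.not_isStronglyNilpotent_of_ode`).

The solutions of the differential equation of order `k` with leading coefficient `a` are
`f = X - Y`, where `Y + a Yᵏ = X`: they exist by differentiating this equation
(`exists_catalan_solution`) and are unique by comparing lowest terms (`coeff_eq_of_ode`). By
Lagrange inversion, here a recurrence for the coefficients of the powers of `Y`, their coefficients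
are the Fuss–Catalan numbers (`coeff_pow_add_mul`). For odd `k` the solution `f` is odd, so outside
condition (iii) the order is `k = 2 s - 2`; `s = 2` is condition (i) and `s ≥ 3` is condition (ii).
-/

open Polynomial

/-! ### Fuss–Catalan numbers and the differential equation -/

section FussCatalan

variable {K : Type*} [Field K]

theorem X_pow_dvd_derivative {M : ℕ} {p : K[X]} (h : X ^ (M + 1) ∣ p) :
    X ^ M ∣ derivative p := by
  obtain ⟨q, rfl⟩ := h
  rw [derivative_mul, derivative_X_pow]
  exact dvd_add ⟨C ((M + 1 : ℕ) : K) * q, by simp; ring⟩ ⟨X * derivative q, by ring⟩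

/-- The equation `Y + a Yᵏ = X` has a root modulo `X ^ N`, found by iterating `Y ↦ X - a Yᵏ`. -/
theorem exists_X_pow_dvd_add_pow_sub_X {k : ℕ} (hk : 2 ≤ k) (a : K) (N : ℕ) :
    ∃ Y : K[X], X ∣ Y ∧ X ^ N ∣ Y + C a * Y ^ k - X := by
  induction N with
  | zero => exact ⟨0, by simp, by simp⟩
  | succ N ih =>
    obtain ⟨Y, ⟨y, rfl⟩, hY⟩ := ih
    obtain ⟨l, rfl⟩ : ∃ l, k = l + 2 := ⟨k - 2, by omega⟩
    set z : K[X] := 1 - C a * X ^ (l + 1) * y ^ (l + 2) with hz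
    have hXz : X * z = X - C a * (X * y) ^ (l + 2) := by rw [hz]; ring
    clear_value z
    refine ⟨X * z, dvd_mul_right _ _, ?_⟩
    have h1 : X ^ N ∣ X * (z - y) := by
      rw [mul_sub, hXz, ← dvd_neg]
      convert hY using 1
      ring
    have h2 : X * (z - y) ∣ X * (z ^ (l + 2) - y ^ (l + 2)) :=
      mul_dvd_mul_left _ (sub_dvd_pow_sub_pow _ _ _)
    obtain ⟨c, hc⟩ := h1.trans h2
    refine ⟨C a * X ^ l * c, ?_⟩
    linear_combination hXz + C a * X ^ (l + 1) * hc

section Coefficients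

variable {k N : ℕ} {a : K} {Y : K[X]}

theorem coeff_pow_of_lt (hX : X ∣ Y) {i j : ℕ} (h : i < j) : (Y ^ j).coeff i = 0 :=
  X_pow_dvd_iff.1 (pow_dvd_pow_of_dvd hX j) i h

/-- Multiplying `Y + a Yᵏ = X` by `Yʲ` gives a recurrence relating the coefficients of the powers
of `Y`. Together with `Y ^ 0 = 1` and `X ∣ Y` it determines all of them. -/
theorem coeff_pow_succ (hk : 2 ≤ k) (hY : X ^ N ∣ Y + C a * Y ^ k - X) {i j : ℕ}
    (hi : i + 1 < N) :
    (Y ^ (j + 1)).coeff (i + 1) =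
      (Y ^ j).coeff i - a * (Y ^ (j + 1 + (k - 1))).coeff (i + 1) := by
  have h := X_pow_dvd_iff.1 (hY.mul_right (Y ^ j)) (i + 1) hi
  have e : (Y + C a * Y ^ k - X) * Y ^ j =
      Y ^ (j + 1) + C a * Y ^ (j + 1 + (k - 1)) - X * Y ^ j := by
    rw [show j + 1 + (k - 1) = k + j by omega]; ring
  rw [e, coeff_sub, coeff_add, coeff_C_mul, coeff_X_mul] at h
  linear_combination h

theorem coeff_pow_self (hk : 2 ≤ k) (hX : X ∣ Y) (hY : X ^ N ∣ Y + C a * Y ^ k - X) {j : ℕ}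
    (hj : j < N) : (Y ^ j).coeff j = 1 := by
  induction j with
  | zero => simp
  | succ j ih =>
    rw [coeff_pow_succ hk hY hj, ih (by omega), coeff_pow_of_lt hX (by omega)]
    simp

theorem coeff_pow_of_not_dvd (hk : 2 ≤ k) (hX : X ∣ Y) (hY : X ^ N ∣ Y + C a * Y ^ k - X)
    (d : ℕ) (hd : ¬ (k - 1) ∣ d) (j : ℕ) (hj : j + d < N) : (Y ^ j).coeff (j + d) = 0 := by
  induction d using Nat.strong_induction_on generalizing j with
  | _ d ihd =>
    induction j with
    | zero =>
      have : d ≠ 0 := by rintro rfl; simp at hd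
      simp [coeff_one, this]
    | succ j ihj =>
      rw [show j + 1 + d = j + d + 1 by ring, coeff_pow_succ hk hY (by omega), ihj (by omega)]
      rcases lt_or_ge d (k - 1) with h | h
      · rw [coeff_pow_of_lt hX (by omega)]; simp
      · have := ihd (d - (k - 1)) (by omega)
          (fun hd' => hd ((Nat.dvd_sub_iff_left h dvd_rfl).1 hd'))
          (j + 1 + (k - 1)) (by omega)
        rw [show j + 1 + (k - 1) + (d - (k - 1)) = j + d + 1 by omega] at this
        rw [this]; simp

variable [CharZero K]

/-- The closed form of `coeff_pow_add_mul` satisfies the recurrence `coeff_pow_succ`. -/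
theorem fussCatalan_recurrence {l j t m : ℕ} (hm : m = j + (l + 1) * (t + 1)) (Q Q' Q'' : K)
    (hQ : Q = ((m + t).choose t : K)) (hQ' : Q' = ((m + t).choose (t + 1) : K))
    (hQ'' : Q'' = ((m + t + 1).choose (t + 1) : K)) :
    (j + 1) / (m + 1) * Q'' = j / m * Q' + (j + l + 2) / (m + 1) * Q := by
  have h1 : Q'' = Q + Q' := by rw [hQ, hQ', hQ'', Nat.choose_succ_succ]; push_cast; rfl
  have h2 : Q' * (t + 1) = Q * m := by
    have := Nat.choose_succ_right_eq (m + t) t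
    rw [Nat.add_sub_cancel] at this
    rw [hQ, hQ']; exact_mod_cast this
  have ht : (t + 1 : K) ≠ 0 := by exact_mod_cast Nat.succ_ne_zero t
  have hm1 : (m + 1 : K) ≠ 0 := by exact_mod_cast Nat.succ_ne_zero m
  have hm0 : (m : K) ≠ 0 := by
    have : 0 < (l + 1) * (t + 1) := by positivity
    exact_mod_cast (by omega : m ≠ 0)
  have h3 : Q' = Q * m / (t + 1) := by rw [← h2]; field_simp
  have hm' : (m : K) = j + (l + 1) * (t + 1) := by exact_mod_cast hm
  rw [h1, h3]
  field_simp
  rw [hm']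
  ring

/-- Lagrange inversion for `Y + a Yᵏ = X`: the coefficients of the powers of `Y`, shifted to
positive exponents `j + 1` so that the denominator `j + 1 + (k - 1) t` does not vanish. -/
theorem coeff_pow_add_mul (hk : 2 ≤ k) (hX : X ∣ Y) (hY : X ^ N ∣ Y + C a * Y ^ k - X)
    (t j : ℕ) (hj : j + 1 + (k - 1) * t < N) :
    (Y ^ (j + 1)).coeff (j + 1 + (k - 1) * t) =
      (-a) ^ t * ((j + 1 : K) / ((j + (k - 1) * t : ℕ) + 1) * ((j + k * t).choose t : K)) := by
  obtain ⟨l, rfl⟩ : ∃ l, k = l + 2 := ⟨k - 2, by omega⟩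
  rw [show l + 2 - 1 = l + 1 by omega] at *
  induction t generalizing j with
  | zero =>
    have : (j + 1 : K) ≠ 0 := by exact_mod_cast Nat.succ_ne_zero j
    simpa [div_self this] using coeff_pow_self hk hX hY (by simpa using hj)
  | succ t iht =>
    induction j with
    | zero =>
      have h1 := iht (l + 1) (by linarith)
      have h2 : (Y ^ 0).coeff (0 + (l + 1) * (t + 1)) = 0 := by
        simp [coeff_one]
      have h3 := fussCatalan_recurrence (l := l) (j := 0) (t := t) rfl _ _ _
        rfl rfl rfl (K := K)
      rw [show 0 + 1 + (l + 1) * (t + 1) = 0 + (l + 1) * (t + 1) + 1 by ring] at hj ⊢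
      rw [coeff_pow_succ hk hY hj, h2,
        show 0 + (l + 1) * (t + 1) + 1 = l + 1 + 1 + (l + 1) * t by ring,
        show 0 + 1 + (l + 2 - 1) = l + 1 + 1 by omega, h1]
      rw [show 0 + (l + 2) * (t + 1) = 0 + (l + 1) * (t + 1) + t + 1 by ring]
      rw [show l + 1 + (l + 2) * t = 0 + (l + 1) * (t + 1) + t by ring,
        show l + 1 + (l + 1) * t = 0 + (l + 1) * (t + 1) by ring]
      push_cast at h3 ⊢
      rw [h3]
      ring
    | succ j ihj =>
      have h1 := iht (j + 1 + l + 1) (by linarith)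
      have h2 := ihj (by omega)
      have h3 := fussCatalan_recurrence (l := l) (j := j + 1) (t := t) rfl _ _ _
        rfl rfl rfl (K := K)
      rw [show j + 1 + 1 + (l + 1) * (t + 1) = j + 1 + (l + 1) * (t + 1) + 1 by ring] at hj ⊢
      rw [coeff_pow_succ hk hY hj, h2,
        show j + 1 + (l + 1) * (t + 1) + 1 = j + 1 + l + 1 + 1 + (l + 1) * t by ring,
        show j + 1 + 1 + (l + 2 - 1) = j + 1 + l + 1 + 1 by omega, h1]
      rw [show j + 1 + (l + 2) * (t + 1) = j + 1 + (l + 1) * (t + 1) + t + 1 by ring,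
        show j + (l + 2) * (t + 1) = j + 1 + (l + 1) * (t + 1) + t by ring]
      rw [show j + 1 + l + 1 + (l + 2) * t = j + 1 + (l + 1) * (t + 1) + t by ring,
        show j + 1 + l + 1 + (l + 1) * t = j + 1 + (l + 1) * (t + 1) by ring]
      push_cast at h3 ⊢
      rw [h3]
      have e : (j + (l + 1) * (t + 1) + 1 : K) = j + 1 + (l + 1) * (t + 1) := by ring
      rw [e]
      ring

theorem coeff_eq_pCatalan (hk : 2 ≤ k) (hX : X ∣ Y) (hY : X ^ N ∣ Y + C a * Y ^ k - X)
    (t : ℕ) (ht : (k - 1) * t + 1 < N) :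
    Y.coeff ((k - 1) * t + 1) = (-a) ^ t * ((pCatalan k t : ℚ) : K) := by
  have h := coeff_pow_add_mul hk hX hY t 0 (by omega)
  rw [zero_add, pow_one, add_comm 1] at h
  rw [h, pCatalan]
  push_cast [Nat.cast_sub (show 1 ≤ k by omega)]
  simp

end Coefficients

/-- The polynomial `F = X - Y`, where `Y + a Yᵏ = X` modulo `X ^ (N + 1)`, has Fuss–Catalan
coefficients. Differentiating `Y + a Yᵏ = X` and multiplying by `Y` eliminates `a` and gives the
differential equation `(X + (k - 1) F) F' = k F`. -/
theorem exists_catalan_solution [CharZero K] {k : ℕ} (hk : 2 ≤ k) (a : K) (N : ℕ) :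
    ∃ F : K[X],
      (∀ t, 1 ≤ t → (k - 1) * t + 1 < N →
        F.coeff ((k - 1) * t + 1) = (-1) ^ (t + 1) * ((pCatalan k t : ℚ) : K) * a ^ t) ∧
      (∀ i, i < N → (∀ t, 1 ≤ t → i ≠ (k - 1) * t + 1) → F.coeff i = 0) ∧
      X ^ N ∣ (X + C (k - 1 : K) * F) * derivative F - C (k : K) * F := by
  obtain ⟨Y, hX, hY⟩ := exists_X_pow_dvd_add_pow_sub_X hk a (N + 1)
  refine ⟨X - Y, fun t ht htN => ?_, fun i hi hit => ?_, ?_⟩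
  · rw [coeff_sub, coeff_eq_pCatalan hk hX hY t (by omega), coeff_X]
    have : 1 ≠ (k - 1) * t + 1 := by
      have : 0 < (k - 1) * t := Nat.mul_pos (by omega) ht
      omega
    rw [if_neg this, neg_pow]
    ring
  · rcases i with _ | d
    · simp [X_dvd_iff.1 hX]
    · by_cases hd : (k - 1) ∣ d
      · obtain ⟨t, rfl⟩ := hd
        obtain rfl : t = 0 := by
          by_contra h
          exact hit t (by omega) rfl
        have := coeff_pow_self hk hX hY (j := 1) (by omega)
        simp_all
      · have := coeff_pow_of_not_dvd hk hX hY d hd 1 (by omega)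
        rw [pow_one, add_comm] at this
        rw [coeff_sub, this, coeff_X]
        have : d ≠ 0 := by rintro rfl; simp at hd
        simpa using this
  · have hE := X_pow_dvd_derivative hY
    obtain ⟨e, he⟩ := hY
    obtain ⟨e', he'⟩ := hE
    obtain ⟨l, rfl⟩ : ∃ l, k = l + 1 := ⟨k - 1, by omega⟩
    rw [derivative_sub, derivative_add, derivative_mul, derivative_pow, derivative_C,
      derivative_X, Nat.add_sub_cancel] at he'
    refine ⟨C ((l + 1 : ℕ) : K) * derivative Y * X * e - Y * e', ?_⟩
    rw [derivative_sub, derivative_X]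
    push_cast at he' ⊢
    simp only [C_add, C_1, map_sub] at he' ⊢
    linear_combination (C (l : K) + 1) * derivative Y * he - Y * he'

/-- A solution of `(X + (k - 1) f) f' = k f` is determined by its coefficients up to degree `k`:
the lowest term `ε Xⁱ` of the difference of two solutions satisfies `(i - k) ε = 0`. -/
theorem coeff_eq_of_ode [CharZero K] {k M : ℕ} {f F : K[X]} (hf2 : X ^ 2 ∣ f)
    (hF2 : X ^ 2 ∣ F)
    (hf : X ^ M ∣ (X + C (k - 1 : K) * f) * derivative f - C (k : K) * f)
    (hF : X ^ M ∣ (X + C (k - 1 : K) * F) * derivative F - C (k : K) * F)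
    (h0 : ∀ i ≤ k, f.coeff i = F.coeff i) : ∀ i < M, f.coeff i = F.coeff i := by
  intro i
  induction i using Nat.strong_induction_on with
  | _ i ih =>
    intro hi
    rcases le_or_gt i k with hik | hik
    · exact h0 i hik
    obtain ⟨j, rfl⟩ : ∃ j, i = j + 1 := ⟨i - 1, by omega⟩
    have hE : X ^ (j + 1) ∣ f - F :=
      X_pow_dvd_iff.2 fun d hd => by rw [coeff_sub, ih d hd (by omega), sub_self]
    have hE' := X_pow_dvd_derivative hE
    rw [derivative_sub] at hE'
    have hF' := X_pow_dvd_derivative hF2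
    have hd := dvd_sub hf hF
    have e1 : X ^ (j + 2) ∣ f * (derivative f - derivative F) := by
      rw [add_comm, pow_add]; exact mul_dvd_mul hf2 hE'
    have e2 : X ^ (j + 2) ∣ (f - F) * derivative F := by
      rw [show j + 2 = j + 1 + 1 by ring, pow_add]; exact mul_dvd_mul hE hF'
    have c0 := X_pow_dvd_iff.1 hd (j + 1) hi
    have c1 := X_pow_dvd_iff.1 e1 (j + 1) (by omega)
    have c2 := X_pow_dvd_iff.1 e2 (j + 1) (by omega)
    have e : (X + C (k - 1 : K) * f) * derivative f - C (k : K) * f -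
        ((X + C (k - 1 : K) * F) * derivative F - C (k : K) * F) =
        X * derivative (f - F) + C (k - 1 : K) * (f * (derivative f - derivative F)) +
        C (k - 1 : K) * ((f - F) * derivative F) - C (k : K) * (f - F) := by
      rw [derivative_sub]; ring
    rw [e, coeff_sub, coeff_add, coeff_add, coeff_C_mul, coeff_C_mul, coeff_C_mul, c1, c2,
      coeff_X_mul, coeff_derivative] at c0
    have hk : ((j + 1 : ℕ) : K) - k ≠ 0 := sub_ne_zero.2 (by exact_mod_cast hik.ne')
    have : (((j + 1 : ℕ) : K) - k) * (f - F).coeff (j + 1) = 0 := by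
      push_cast; linear_combination c0
    rw [mul_eq_zero, or_iff_right hk, coeff_sub] at this
    exact sub_eq_zero.1 this

end FussCatalan

/-! ### The polynomial model of the algebra -/

namespace LeibnizAlgebra

section Model

variable {K L : Type*} [Field K] [AddCommGroup L] [Module K L] {n : ℕ}

/-- The polynomial `∑ αₜ Xᵗ⁻²`, by which right multiplication by `e₂` acts on the span of
`e₂, …, eₙ`, when `Xⁱ` stands for `eᵢ₊₂`. -/
noncomputable def structurePoly (n : ℕ) (α : ℕ → K) : K[X] :=
  ∑ t ∈ Icc 4 n, C (α t) * X ^ (t - 2)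

theorem coeff_structurePoly (α : ℕ → K) (i : ℕ) :
    (structurePoly n α).coeff i = if 2 ≤ i ∧ i + 2 ≤ n then α (i + 2) else 0 := by
  rw [structurePoly, finsetSum_coeff]
  simp only [coeff_C_mul_X_pow]
  split_ifs with h
  · rw [Finset.sum_eq_single (i + 2)]
    · simp
    · intro t ht hti
      rw [Finset.mem_Icc] at ht
      rw [if_neg (by omega)]
    · intro h'
      exact absurd (Finset.mem_Icc.2 (by omega)) h'
  · refine Finset.sum_eq_zero fun t ht => ?_
    rw [Finset.mem_Icc] at ht
    rw [if_neg (by omega)]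

theorem X_sq_dvd_structurePoly (α : ℕ → K) : X ^ 2 ∣ structurePoly n α :=
  X_pow_dvd_iff.2 fun d hd => by rw [coeff_structurePoly, if_neg (by omega)]

theorem X_dvd_structurePoly (α : ℕ → K) : X ∣ structurePoly n α :=
  (dvd_pow_self X two_ne_zero).trans (X_sq_dvd_structurePoly α)

variable (b : Module.Basis (Fin n) K L)

/-- The linear map `K[X] → L` with `Xⁱ ↦ eᵢ₊₂`. Since `basisVec b i = 0` for `i > n`, its kernel
is the ideal generated by `X ^ (n - 1)`. -/
noncomputable def ofPoly : K[X] →ₗ[K] L :=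
  (Polynomial.basisMonomials K).constr K fun i => basisVec b (i + 2)

/-- The linear map `L → K[X]` with `e₁ ↦ 1` and `eᵢ₊₂ ↦ Xⁱ`. The truncated subtraction gives
`e₁` and `e₂`, which have indices `0` and `1` in `Fin n`, the same image. -/
noncomputable def toPoly : L →ₗ[K] K[X] :=
  b.constr K fun i => X ^ (i.val - 1)

/-- The coordinate of `e₁`. -/
noncomputable def fstCoord : L →ₗ[K] K :=
  b.constr K fun i => if i.val = 0 then 1 else 0

/-- The coordinate of `e₂`. -/
noncomputable def sndCoord : L →ₗ[K] K :=
  b.constr K fun i => if i.val = 1 then 1 else 0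

/-- The polynomial by which right multiplication by `v` acts on the polynomial model: `e₁` acts as
`X`, `e₂` as `f`, and the other basis vectors as `0`. -/
noncomputable def rightPoly (f : K[X]) (v : L) : K[X] :=
  C (fstCoord b v) * X + C (sndCoord b v) * f

theorem basis_eq_basisVec (i : Fin n) : b i = basisVec b (i.val + 1) := by
  rw [basisVec, dif_pos (by omega)]
  rfl

theorem basisVec_of_lt {i : ℕ} (h : n < i) : basisVec b i = 0 := by
  rw [basisVec, dif_neg (by omega)]

theorem basisVec_succ {i : ℕ} (h : i < n) : basisVec b (i + 1) = b ⟨i, h⟩ := by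
  rw [basis_eq_basisVec]

theorem ofPoly_X_pow (i : ℕ) : ofPoly b (X ^ i) = basisVec b (i + 2) := by
  have := (Polynomial.basisMonomials K).constr_basis K (fun i => basisVec b (i + 2)) i
  rwa [coe_basisMonomials, show (fun s => monomial s (1 : K)) i = X ^ i from
    (X_pow_eq_monomial i).symm] at this

theorem ofPoly_C_mul (c : K) (p : K[X]) : ofPoly b (C c * p) = c • ofPoly b p := by
  rw [← smul_eq_C_mul, map_smul]

theorem toPoly_basisVec {i : ℕ} (h1 : 1 ≤ i) (h : i ≤ n) :
    toPoly b (basisVec b i) = X ^ (i - 2) := by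
  obtain ⟨i, rfl⟩ : ∃ j, i = j + 1 := ⟨i - 1, by omega⟩
  rw [basisVec_succ b (by omega), toPoly, Module.Basis.constr_basis]
  congr 1

theorem fstCoord_basisVec {i : ℕ} (h1 : 1 ≤ i) (h : i ≤ n) :
    fstCoord b (basisVec b i) = if i = 1 then 1 else 0 := by
  obtain ⟨i, rfl⟩ : ∃ j, i = j + 1 := ⟨i - 1, by omega⟩
  rw [basisVec_succ b (by omega), fstCoord, Module.Basis.constr_basis]
  simp

theorem sndCoord_basisVec {i : ℕ} (h1 : 1 ≤ i) (h : i ≤ n) :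
    sndCoord b (basisVec b i) = if i = 2 then 1 else 0 := by
  obtain ⟨i, rfl⟩ : ∃ j, i = j + 1 := ⟨i - 1, by omega⟩
  rw [basisVec_succ b (by omega), sndCoord, Module.Basis.constr_basis]
  simp

theorem ofPoly_eq_zero_of_dvd {p : K[X]} (h : X ^ (n - 1) ∣ p) : ofPoly b p = 0 := by
  obtain ⟨q, rfl⟩ := h
  induction q using Polynomial.induction_on' with
  | add p q hp hq => rw [mul_add, map_add, hp, hq, add_zero]
  | monomial i c =>
    rw [← C_mul_X_pow_eq_monomial, mul_left_comm, ofPoly_C_mul, ← pow_add, ofPoly_X_pow,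
      basisVec_of_lt b (by omega), smul_zero]

theorem ofPoly_congr {p q : K[X]} (h : X ^ (n - 1) ∣ p - q) : ofPoly b p = ofPoly b q := by
  rw [← sub_eq_zero, ← map_sub]
  exact ofPoly_eq_zero_of_dvd b h

theorem dvd_toPoly_ofPoly_sub (p : K[X]) : X ^ (n - 1) ∣ toPoly b (ofPoly b p) - p := by
  induction p using Polynomial.induction_on' with
  | add p q hp hq =>
    rw [map_add, map_add, add_sub_add_comm]
    exact dvd_add hp hq
  | monomial i c =>
    rw [← C_mul_X_pow_eq_monomial, ofPoly_C_mul, map_smul, smul_eq_C_mul, ← mul_sub,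
      ofPoly_X_pow]
    refine Dvd.dvd.mul_left ?_ _
    rcases le_or_gt (i + 2) n with h | h
    · rw [toPoly_basisVec b (by omega) h]
      simp
    · rw [basisVec_of_lt b h, map_zero, zero_sub, dvd_neg]
      exact pow_dvd_pow _ (by omega)

theorem ofPoly_eq_zero_iff {p : K[X]} : ofPoly b p = 0 ↔ X ^ (n - 1) ∣ p := by
  refine ⟨fun h => ?_, ofPoly_eq_zero_of_dvd b⟩
  have := dvd_toPoly_ofPoly_sub b p
  rwa [h, map_zero, zero_sub, dvd_neg] at this

theorem ofPoly_toPoly_add (v : L) :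
    ofPoly b (toPoly b v) + fstCoord b v • (basisVec b 1 - basisVec b 2) = v := by
  have : ofPoly b ∘ₗ toPoly b + (fstCoord b).smulRight (basisVec b 1 - basisVec b 2) =
      LinearMap.id := by
    refine b.ext fun i => ?_
    have hi := i.2
    simp only [basis_eq_basisVec, LinearMap.add_apply, LinearMap.comp_apply,
      LinearMap.smulRight_apply, LinearMap.id_apply, toPoly_basisVec b (Nat.le_add_left _ _) hi,
      fstCoord_basisVec b (Nat.le_add_left _ _) hi, ofPoly_X_pow]
    rcases Nat.eq_zero_or_pos i.val with h | h
    · simp [h]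
    · rw [if_neg (by omega), show i.val + 1 - 2 + 2 = i.val + 1 by omega]
      simp
  exact LinearMap.congr_fun this v

theorem fstCoord_ofPoly (p : K[X]) : fstCoord b (ofPoly b p) = 0 := by
  induction p using Polynomial.induction_on' with
  | add p q hp hq => rw [map_add, map_add, hp, hq, add_zero]
  | monomial i c =>
    rw [← C_mul_X_pow_eq_monomial, ofPoly_C_mul, ofPoly_X_pow, map_smul]
    rcases le_or_gt (i + 2) n with h | h
    · simp [fstCoord_basisVec b (Nat.le_add_left 1 (i + 1)) h]
    · simp [basisVec_of_lt b h]

theorem coeff_zero_toPoly (v : L) : (toPoly b v).coeff 0 = fstCoord b v + sndCoord b v := by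
  have : lcoeff K 0 ∘ₗ toPoly b = fstCoord b + sndCoord b := by
    refine b.ext fun i => ?_
    have hi := i.2
    simp only [basis_eq_basisVec, LinearMap.add_apply, LinearMap.comp_apply, lcoeff_apply,
      toPoly_basisVec b (Nat.le_add_left _ _) hi,
      fstCoord_basisVec b (Nat.le_add_left _ _) hi, sndCoord_basisVec b (Nat.le_add_left _ _) hi,
      coeff_X_pow]
    rcases i with ⟨_ | _ | i, h⟩ <;> simp
  exact LinearMap.congr_fun this v

theorem toPoly_basisVec_one_sub (hn : 2 ≤ n) :
    toPoly b (basisVec b 1 - basisVec b 2) = 0 := by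
  rw [map_sub, toPoly_basisVec b (by omega) (by omega), toPoly_basisVec b (by omega) (by omega)]
  simp

theorem rightPoly_one (hn : 1 ≤ n) (f : K[X]) : rightPoly b f (basisVec b 1) = X := by
  simp [rightPoly, fstCoord_basisVec b le_rfl hn, sndCoord_basisVec b le_rfl hn]

theorem rightPoly_two (hn : 2 ≤ n) (f : K[X]) : rightPoly b f (basisVec b 2) = f := by
  simp [rightPoly, fstCoord_basisVec b one_le_two hn, sndCoord_basisVec b one_le_two hn]

theorem rightPoly_add (f : K[X]) (v w : L) :
    rightPoly b f (v + w) = rightPoly b f v + rightPoly b f w := by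
  simp only [rightPoly, map_add]; ring

theorem rightPoly_smul (f : K[X]) (c : K) (v : L) :
    rightPoly b f (c • v) = c • rightPoly b f v := by
  simp only [rightPoly, map_smul, smul_eq_C_mul, smul_eq_mul, map_mul]; ring

variable {b} {α : ℕ → K} {θ : K}

theorem ofPoly_X_pow_mul_structurePoly (i : ℕ) :
    ofPoly b (X ^ i * structurePoly n α) = ∑ t ∈ Icc 4 n, α t • basisVec b (i + t) := by
  rw [structurePoly, mul_sum, map_sum]
  refine sum_congr rfl fun t ht => ?_
  rw [Finset.mem_Icc] at ht
  rw [mul_left_comm, ofPoly_C_mul, ← pow_add, ofPoly_X_pow, show i + (t - 2) + 2 = i + t by omega]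

theorem X_dvd_rightPoly (v : L) : X ∣ rightPoly b (structurePoly n α) v :=
  dvd_add (dvd_mul_left _ _) ((X_dvd_structurePoly α).mul_left _)

variable [LeibnizAlgebra K L]

/-- The bracket in the polynomial model. The last term accounts for `[e₁ - e₂, e₂]`, the only
product of `e₁ - e₂` with a basis vector that can be nonzero. -/
theorem IsF1Basis.br_eq (hb : IsF1Basis α θ b) (hn : 4 ≤ n) (v w : L) :
    br K v w = ofPoly b (toPoly b v * rightPoly b (structurePoly n α) w) +
      (fstCoord b v * sndCoord b w) • ((θ - α n) • basisVec b n) := by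
  set f := structurePoly n α with hf
  have key : bracket (K := K) (L := L) = LinearMap.mk₂ K (fun v w =>
      ofPoly b (toPoly b v * rightPoly b f w) +
        (fstCoord b v * sndCoord b w) • ((θ - α n) • basisVec b n))
      (fun v v' w => by simp only [map_add, add_mul, add_smul]; abel)
      (fun c v w => by
        simp only [map_smul, smul_eq_mul, smul_add, smul_mul_assoc, mul_smul])
      (fun v w w' => by
        simp only [rightPoly_add, map_add, mul_add, add_smul]; abel)
      (fun c v w => by
        simp only [rightPoly_smul, map_smul, smul_eq_mul, smul_add, mul_smul_comm, mul_smul]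
        rw [smul_comm c (fstCoord b v)]) := by
    refine b.ext fun i => b.ext fun j => ?_
    rw [LinearMap.mk₂_apply, basis_eq_basisVec, basis_eq_basisVec]
    have hi := i.2
    have hj := j.2
    change br K _ _ = _
    generalize i.val = i at *
    generalize j.val = j at *
    rw [toPoly_basisVec b (Nat.le_add_left _ _) hi, fstCoord_basisVec b (Nat.le_add_left _ _) hi,
      sndCoord_basisVec b (Nat.le_add_left _ _) hj]
    rcases j with _ | _ | j
    · rw [rightPoly_one b (by omega), ← pow_succ, ofPoly_X_pow]
      rcases i with _ | i
      · simpa using hb.one_one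
      · rcases Nat.lt_or_ge (i + 2) n with h | h
        · rw [hb.mul_one (i + 1 + 1) (by omega) (by omega)]
          simp
        · obtain rfl : n = i + 1 + 1 := by omega
          rw [hb.last_one, basisVec_of_lt b (by omega)]
          simp
    · rw [rightPoly_two b (by omega), hf, ofPoly_X_pow_mul_structurePoly]
      rcases i with _ | i
      · have e : Icc 4 n = insert n (Icc 4 (n - 1)) := by
          ext t; simp only [Finset.mem_Icc, Finset.mem_insert]; omega
        rw [hb.one_two, e, sum_insert (by simp; omega)]
        simp [sub_smul]
        abel
      · rw [if_neg (by omega), zero_mul, zero_smul, add_zero]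
        rcases Nat.lt_or_ge (i + 3) n with h | h
        · rw [hb.mul_two (i + 1 + 1) (by omega) (by omega)]
          refine Eq.trans ?_ (Finset.sum_subset (s₁ := Icc 4 (n - i)) ?_ ?_)
          · refine Finset.sum_bij' (fun t _ => t - i) (fun t _ => i + t) ?_ ?_ ?_ ?_ ?_
            all_goals intro t ht; rw [Finset.mem_Icc] at ht
            · rw [Finset.mem_Icc]; omega
            · rw [Finset.mem_Icc]; omega
            · omega
            · omega
            · rw [show t - (i + 1 + 1) + 2 = t - i by omega,
                show i + 1 + 1 - 2 + (t - i) = t by omega]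
          · exact Icc_subset_Icc_right (Nat.sub_le _ _)
          · intro t ht ht'
            rw [Finset.mem_Icc] at ht ht'
            rw [basisVec_of_lt b (by omega), smul_zero]
        · rw [hb.last_two _ (by omega) (by omega)]
          refine (sum_eq_zero fun t ht => ?_).symm
          rw [Finset.mem_Icc] at ht
          rw [basisVec_of_lt b (by omega), smul_zero]
    · rw [hb.mul_ge_three _ _ (by omega) (by omega) (by omega) (by omega)]
      simp [rightPoly, fstCoord_basisVec b (Nat.le_add_left _ _) hj,
        sndCoord_basisVec b (Nat.le_add_left _ _) hj]
  exact LinearMap.congr_fun (LinearMap.congr_fun key v) w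

/-- In triple products the exceptional term of `IsF1Basis.br_eq` disappears, as `eₙ` is
annihilated by all right multiplications. -/
theorem IsF1Basis.br_br (hb : IsF1Basis α θ b) (hn : 4 ≤ n) (v w z : L) :
    br K (br K v w) z = ofPoly b (toPoly b v * rightPoly b (structurePoly n α) w *
      rightPoly b (structurePoly n α) z) := by
  have h1 : fstCoord b (br K v w) = 0 := by
    rw [hb.br_eq hn, map_add, fstCoord_ofPoly, map_smul, map_smul,
      fstCoord_basisVec b (by omega) le_rfl, if_neg (by omega)]
    simp
  rw [hb.br_eq hn _ z, h1, zero_mul, zero_smul, add_zero]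
  apply ofPoly_congr
  rw [← sub_mul, hb.br_eq hn v w, map_add, map_smul, map_smul, toPoly_basisVec b (by omega) le_rfl,
    add_sub_right_comm, add_mul]
  refine dvd_add ((dvd_toPoly_ofPoly_sub b _).mul_right _) ?_
  rw [show n - 1 = n - 2 + 1 by omega, pow_succ]
  refine mul_dvd_mul ?_ (X_dvd_rightPoly z)
  rw [smul_smul, smul_eq_C_mul]
  exact dvd_mul_left _ _

theorem IsF1Basis.isPreDerivation_iff (hb : IsF1Basis α θ b) (hn : 4 ≤ n)
    {P : Module.End K L} {f : K[X]} (hf : structurePoly n α = f) :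
    IsPreDerivation K P ↔ ∀ v w z : L,
      P (ofPoly b (toPoly b v * rightPoly b f w * rightPoly b f z)) =
        ofPoly b (toPoly b (P v) * rightPoly b f w * rightPoly b f z +
          toPoly b v * rightPoly b f (P w) * rightPoly b f z +
          toPoly b v * rightPoly b f w * rightPoly b f (P z)) := by
  subst hf
  simp only [IsPreDerivation, hb.br_br hn, map_add]

end Model

end LeibnizAlgebra

/-! ### Construction of non-nilpotent pre-derivations -/

namespace LeibnizAlgebra

section Construction

variable {K L : Type*} [Field K] [AddCommGroup L] [Module K L] {n : ℕ}
  {b : Module.Basis (Fin n) K L} {α : ℕ → K} {θ : K}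

theorem coeff_aeval_neg_X (p : K[X]) (i : ℕ) :
    (aeval (-X : K[X]) p).coeff i = (-1) ^ i * p.coeff i := by
  rw [← comp_eq_aeval, show (-X : K[X]) = C (-1) * X by simp, comp_C_mul_X_coeff, mul_comm]

theorem X_pow_dvd_aeval_neg_X {p : K[X]} {N : ℕ} (h : X ^ N ∣ p) :
    X ^ N ∣ aeval (-X : K[X]) p :=
  X_pow_dvd_iff.2 fun d hd => by rw [coeff_aeval_neg_X, X_pow_dvd_iff.1 h d hd, mul_zero]

/-- The operator `p ↦ h p' + d p + ν p(-X)` on polynomials. The reflection `p(-X)` commutes with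
multiplication by `X²`, so its coefficient `ν` is not constrained by the product rule for `X²`. -/
noncomputable def reflectionOperator (h d ν : K[X]) : K[X] →ₗ[K] K[X] :=
  LinearMap.mulLeft K h ∘ₗ derivative + LinearMap.mulLeft K d +
    LinearMap.mulLeft K ν ∘ₗ (aeval (-X : K[X])).toLinearMap

theorem reflectionOperator_apply (h d ν p : K[X]) :
    reflectionOperator h d ν p = h * derivative p + d * p + ν * aeval (-X : K[X]) p := rfl

theorem X_pow_dvd_reflectionOperator {h d ν p : K[X]} (hh : X ∣ h) {N : ℕ} (hp : X ^ N ∣ p) :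
    X ^ N ∣ reflectionOperator h d ν p := by
  rw [reflectionOperator_apply]
  refine dvd_add (dvd_add ?_ (hp.mul_left _)) ((X_pow_dvd_aeval_neg_X hp).mul_left _)
  cases N with
  | zero => simp
  | succ N =>
    rw [pow_succ']
    exact mul_dvd_mul hh (X_pow_dvd_derivative hp)

variable [LeibnizAlgebra K L]

/-- A reflection operator induces a pre-derivation when its defects in the product rule for
multiplication by `X f` and by `f²` vanish modulo `X ^ (n - 1)`. The defect for `X f` is `X` times
`r p - ν (f(-X) + f) p(-X)`, hence only the coefficients of degree `n - 3` of `r` and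
`ν (f(-X) + f)` have to agree. -/
theorem IsF1Basis.exists_isPreDerivation (hb : IsF1Basis α θ b) (hn : 4 ≤ n) (κ δ : K)
    (h d ν r f : K[X]) (hf : structurePoly n α = f)
    (hh : h = C κ * X + C (δ - κ) * f) (hδ : (d + ν).coeff 0 = δ)
    (hr : r = h * derivative f - C δ * f)
    (h1 : X ^ (n - 2) ∣ r - ν * (aeval (-X : K[X]) f + f))
    (h2 : X ^ (n - 3) ∣ ν * (aeval (-X : K[X]) f + f))
    (h3 : X ^ (n - 1) ∣ ν * (aeval (-X : K[X]) f + f) ^ 2) :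
    ∃ P : Module.End K L, IsPreDerivation K P ∧
      (∀ q, P (ofPoly b q) = ofPoly b (reflectionOperator h d ν q)) ∧
      P (basisVec b 1 - basisVec b 2) = κ • (basisVec b 1 - basisVec b 2) := by
  have hXf : X ∣ f := hf ▸ X_dvd_structurePoly α
  have hXh : X ∣ h := by
    rw [hh]
    exact dvd_add (dvd_mul_left _ _) (hXf.mul_left _)
  set D := reflectionOperator h d ν with hD
  have hDdvd : ∀ p : K[X], X ^ (n - 1) ∣ p → X ^ (n - 1) ∣ D p := fun p hp =>
    X_pow_dvd_reflectionOperator hXh hp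
  have hD0 : ∀ p : K[X], (D p).coeff 0 = δ * p.coeff 0 := by
    intro p
    rw [hD, reflectionOperator_apply, coeff_add, coeff_add, mul_coeff_zero, mul_coeff_zero,
      mul_coeff_zero, X_dvd_iff.1 hXh, coeff_aeval_neg_X, ← hδ, coeff_add]
    ring
  set P : Module.End K L := ofPoly b ∘ₗ D ∘ₗ toPoly b +
    (fstCoord b).smulRight (κ • (basisVec b 1 - basisVec b 2)) with hP
  have hPv : ∀ v, P v = ofPoly b (D (toPoly b v)) +
      fstCoord b v • κ • (basisVec b 1 - basisVec b 2) := fun v => rfl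
  have hPq : ∀ q, P (ofPoly b q) = ofPoly b (D q) := by
    intro q
    rw [hPv, fstCoord_ofPoly, zero_smul, add_zero]
    apply ofPoly_congr
    rw [← map_sub]
    exact hDdvd _ (dvd_toPoly_ofPoly_sub b q)
  have ht : ∀ v, X ^ (n - 1) ∣ toPoly b (P v) - D (toPoly b v) := by
    intro v
    rw [hPv, map_add, map_smul, map_smul, toPoly_basisVec_one_sub b (by omega), smul_zero,
      smul_zero, add_zero]
    exact dvd_toPoly_ofPoly_sub b _
  have hfst : ∀ v, fstCoord b (P v) = κ * fstCoord b v := by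
    intro v
    rw [hPv, map_add, fstCoord_ofPoly, map_smul, map_smul, map_sub,
      fstCoord_basisVec b (by omega) (by omega), fstCoord_basisVec b (by omega) (by omega)]
    simp [mul_comm]
  have hsnd : ∀ v, sndCoord b (P v) =
      δ * (fstCoord b v + sndCoord b v) - κ * fstCoord b v := by
    intro v
    have e1 := coeff_zero_toPoly b (P v)
    have e2 := X_pow_dvd_iff.1 (ht v) 0 (by omega)
    rw [coeff_sub, hD0, coeff_zero_toPoly b v] at e2
    rw [hfst] at e1
    linear_combination e2 - e1
  have hright : ∀ v, rightPoly b f (P v) =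
      C (fstCoord b v) * h + C (sndCoord b v) * (C δ * f) := by
    intro v
    rw [rightPoly, hfst, hsnd, hh]
    simp only [map_sub, map_mul, map_add]
    ring
  refine ⟨P, (hb.isPreDerivation_iff hn hf).2 fun v w z => ?_, hPq, ?_⟩
  · rw [hPq]
    apply ofPoly_congr
    rw [hright, hright]
    have hA := ht v
    generalize toPoly b (P v) = A at *
    generalize toPoly b v = p at *
    rw [rightPoly, rightPoly]
    generalize fstCoord b w = w1
    generalize sndCoord b w = w2
    generalize fstCoord b z = z1
    generalize sndCoord b z = z2
    set Sf := aeval (-X : K[X]) f with hSf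
    set Sp := aeval (-X : K[X]) p with hSp
    have hT : X ^ (n - 2) ∣ r * p - ν * (Sf + f) * Sp := by
      have e : r * p - ν * (Sf + f) * Sp =
          (r - ν * (Sf + f)) * p + ν * (Sf + f) * (p - Sp) := by ring
      rw [e]
      refine dvd_add (h1.mul_right _) ?_
      rw [show n - 2 = n - 3 + 1 by omega, pow_succ]
      refine mul_dvd_mul h2 (X_dvd_iff.2 ?_)
      rw [coeff_sub, hSp, coeff_aeval_neg_X]
      simp
    have hXT : ∀ u : K[X], X ∣ u → X ^ (n - 1) ∣ u * (r * p - ν * (Sf + f) * Sp) := by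
      intro u hu
      rw [show n - 1 = n - 2 + 1 by omega, pow_succ']
      exact mul_dvd_mul hu hT
    have e : D (p * (C w1 * X + C w2 * f) * (C z1 * X + C z2 * f)) -
        (A * (C w1 * X + C w2 * f) * (C z1 * X + C z2 * f) +
          p * (C w1 * h + C w2 * (C δ * f)) * (C z1 * X + C z2 * f) +
          p * (C w1 * X + C w2 * f) * (C z1 * h + C z2 * (C δ * f))) =
        C (w1 * z2 + w2 * z1) * (X * (r * p - ν * (Sf + f) * Sp)) +
          C (w2 * z2) * (2 * (f * (r * p - ν * (Sf + f) * Sp)) + ν * (Sf + f) ^ 2 * Sp) -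
          (A - D p) * ((C w1 * X + C w2 * f) * (C z1 * X + C z2 * f)) := by
      rw [hD, reflectionOperator_apply, reflectionOperator_apply, hr]
      simp only [map_mul, map_add, derivative_mul, derivative_C, derivative_X, aeval_X, aeval_C,
        ← hSf, ← hSp, algebraMap_eq]
      ring
    rw [e]
    refine dvd_sub (dvd_add ((hXT X dvd_rfl).mul_left _) ((dvd_add ?_ ?_).mul_left _))
      (hA.mul_right _)
    · exact (hXT f hXf).mul_left _
    · exact h3.mul_right _
  · rw [hPv, toPoly_basisVec_one_sub b (by omega), map_zero, map_zero, zero_add, map_sub,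
      fstCoord_basisVec b (by omega) (by omega), fstCoord_basisVec b (by omega) (by omega)]
    simp

theorem not_isStronglyNilpotent_of_eigenvector {P : Module.End K L} (hP : IsPreDerivation K P)
    {c : K} (hc : c ≠ 0) {v : L} (hv : v ≠ 0) (hPv : P v = c • v) :
    ¬ IsStronglyNilpotent K L := by
  intro hL
  obtain ⟨m, hm⟩ := hL P hP
  have : ∀ m : ℕ, (P ^ m) v = c ^ m • v := by
    intro m
    induction m with
    | zero => simp
    | succ m ih => rw [pow_succ', Module.End.mul_apply, ih, map_smul, hPv, smul_smul, pow_succ]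
  have h := this m
  rw [hm, LinearMap.zero_apply] at h
  exact smul_ne_zero (pow_ne_zero m hc) hv h.symm

theorem coeff_aeval_neg_X_add (p : K[X]) (i : ℕ) :
    (aeval (-X : K[X]) p + p).coeff i = if Even i then 2 * p.coeff i else 0 := by
  rw [coeff_add, coeff_aeval_neg_X]
  split_ifs with h
  · rw [h.neg_one_pow]; ring
  · rw [(Nat.not_even_iff_odd.1 h).neg_one_pow]; ring

/-- If `f` is odd up to degree `n - 3`, then `p ↦ p - p(-X)`, twice the projection onto the odd
part, induces a pre-derivation; it has `e₃` as an eigenvector. -/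
theorem IsF1Basis.not_isStronglyNilpotent_of_even [CharZero K] (hb : IsF1Basis α θ b)
    (hn : 4 ≤ n) (hev : Even n) (hα : ∀ i, 2 ≤ i → i ≤ (n - 2) / 2 → α (2 * i) = 0) :
    ¬ IsStronglyNilpotent K L := by
  set f := structurePoly n α with hf
  have h0 : X ^ (n - 2) ∣ aeval (-X : K[X]) f + f := by
    refine X_pow_dvd_iff.2 fun i hi => ?_
    rw [coeff_aeval_neg_X_add]
    split_ifs with h
    · rw [hf, coeff_structurePoly]
      split_ifs with h'
      · obtain ⟨j, rfl⟩ := h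
        obtain ⟨m, rfl⟩ := hev
        rw [show j + j + 2 = 2 * (j + 1) by ring, hα _ (by omega) (by omega), mul_zero]
      · rw [mul_zero]
    · rfl
  obtain ⟨P, hP, hPq, -⟩ := hb.exists_isPreDerivation hn 0 0 0 1 (-1) 0 f rfl (by simp)
    (by simp) (by simp) (by simpa using h0)
    ((pow_dvd_pow _ (by omega)).trans (h0.mul_left _))
    (((pow_dvd_pow X (show n - 1 ≤ (n - 2) * 2 by omega)).trans
      (pow_mul (X : K[X]) (n - 2) 2 ▸ pow_dvd_pow_of_dvd h0 2)).mul_left _)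
  refine not_isStronglyNilpotent_of_eigenvector hP (two_ne_zero (α := K))
    (v := ofPoly b X) ?_ ?_
  · intro h
    have := X_pow_dvd_iff.1 ((ofPoly_eq_zero_iff b).1 h) 1 (by omega)
    simp at this
  · rw [hPq, ← map_smul, reflectionOperator_apply, aeval_X, smul_eq_C_mul, C_ofNat]
    congr 1
    ring

/-- If `f` solves the differential equation modulo `X ^ (n - 3)`, the error in degree `n - 3` is
compensated by a multiple of the reflection. The resulting pre-derivation fixes `e₁ - e₂`. -/
theorem IsF1Basis.not_isStronglyNilpotent_of_ode [CharZero K] (hb : IsF1Basis α θ b) {s : ℕ}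
    (hs : 2 ≤ s) (hsn : 2 * s ≤ n - 2) (f : K[X]) (hf : structurePoly n α = f)
    (ha : α (2 * s) ≠ 0)
    (hlow : ∀ i < 2 * s - 2, f.coeff i = 0)
    (hode : X ^ (n - 3) ∣ (X + C ((2 * s - 2 : ℕ) - 1 : K) * f) * derivative f -
      C ((2 * s - 2 : ℕ) : K) * f) :
    ¬ IsStronglyNilpotent K L := by
  set k := 2 * s - 2 with hk
  set r := (X + C ((k : K) - 1) * f) * derivative f - C (k : K) * f with hr
  have hsum : X ^ k ∣ aeval (-X : K[X]) f + f := by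
    refine X_pow_dvd_iff.2 fun i hi => ?_
    rw [coeff_aeval_neg_X_add, hlow i hi, mul_zero, ite_self]
  have hk2 : (aeval (-X : K[X]) f + f).coeff k = 2 * α (2 * s) := by
    rw [coeff_aeval_neg_X_add, if_pos ⟨s - 1, by omega⟩, ← hf, coeff_structurePoly,
      if_pos (by omega), show k + 2 = 2 * s by omega]
  -- The value of `μ` matching the coefficients of degree `n - 3`.
  set μ := r.coeff (n - 3) / (2 * α (2 * s)) with hμ
  have hν : ∀ q : K[X], X ^ k ∣ q → X ^ (n - 3) ∣ C μ * X ^ (n - 3 - k) * q := by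
    intro q hq
    rw [mul_assoc, show X ^ (n - 3) = X ^ (n - 3 - k) * (X : K[X]) ^ k by
      rw [← pow_add]; congr 1; omega]
    exact (mul_dvd_mul_left _ hq).mul_left _
  have h1 : X ^ (n - 2) ∣ r - C μ * X ^ (n - 3 - k) * (aeval (-X : K[X]) f + f) := by
    refine X_pow_dvd_iff.2 fun i hi => ?_
    rcases Nat.lt_or_ge i (n - 3) with h | h
    · rw [coeff_sub, X_pow_dvd_iff.1 hode i h, X_pow_dvd_iff.1 (hν _ hsum) i h, sub_zero]
    · obtain rfl : i = k + (n - 3 - k) := by omega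
      rw [coeff_sub, mul_assoc, coeff_C_mul, coeff_X_pow_mul', if_pos (by omega),
        Nat.add_sub_cancel, hk2, hμ, show k + (n - 3 - k) = n - 3 by omega]
      field_simp
      ring
  have h3 : X ^ (n - 1) ∣ C μ * X ^ (n - 3 - k) * (aeval (-X : K[X]) f + f) ^ 2 := by
    rw [pow_two, ← mul_assoc, show n - 1 = n - 3 + 2 by omega, pow_add]
    exact mul_dvd_mul (hν _ hsum) ((pow_dvd_pow _ (by omega)).trans hsum)
  have hδ : (C (k : K) + C μ * X ^ (n - 3 - k)).coeff 0 = (k : K) := by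
    rw [coeff_add, coeff_C_mul_X_pow, if_neg (by omega), coeff_C_zero, add_zero]
  obtain ⟨P, hP, -, hPu⟩ := hb.exists_isPreDerivation (by omega) 1 (k : K)
    (X + C ((k : K) - 1) * f) (C (k : K)) (C μ * X ^ (n - 3 - k)) r f hf
    (by simp) hδ rfl h1 (hν _ hsum) h3
  refine not_isStronglyNilpotent_of_eigenvector hP one_ne_zero
    (v := basisVec b 1 - basisVec b 2) (fun h => ?_) hPu
  have := congrArg (fstCoord b) h
  rw [map_sub, fstCoord_basisVec b (by omega) (by omega),
    fstCoord_basisVec b (by omega) (by omega)] at this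
  simp at this

end Construction

end LeibnizAlgebra

/-! ### Constraints on a non-nilpotent pre-derivation -/

section EvenOdd

variable {K : Type*} [Field K]

/-- The decomposition of a polynomial into its even and odd parts. -/
theorem expand_contract_two_add (f : K[X]) :
    expand K 2 (contract 2 f) + X * expand K 2 (contract 2 f.divX) = f := by
  ext i
  rw [coeff_add]
  rcases Nat.even_or_odd' i with ⟨j, rfl | rfl⟩
  · have : (X * expand K 2 (contract 2 f.divX)).coeff (2 * j) = 0 := by
      cases j with
      | zero => simp
      | succ j =>
        rw [show 2 * (j + 1) = 2 * j + 1 + 1 by ring, coeff_X_mul, coeff_expand two_pos,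
          if_neg (by omega)]
    rw [this, coeff_expand_mul' two_pos, coeff_contract two_ne_zero, mul_comm, add_zero]
  · rw [coeff_X_mul, coeff_expand_mul' two_pos, coeff_contract two_ne_zero, coeff_divX,
      coeff_expand two_pos, if_neg (by omega), mul_comm j, zero_add]

variable {D : K[X] →ₗ[K] K[X]} {N : ℕ} {h : K[X]}

/-- A product rule for multiplication by `X²` extends to all even polynomials. -/
theorem dvd_map_expand_mul_sub (hD : ∀ p, X ^ N ∣ D (p * X ^ 2) - (D p * X ^ 2 + 2 * p * X * h))
    (R w : K[X]) :
    X ^ N ∣ D (expand K 2 R * w) -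
      (expand K 2 R * D w + derivative (expand K 2 R) * h * w) := by
  induction R using Polynomial.induction_on' with
  | add p q hp hq =>
    rw [map_add, add_mul, map_add]
    convert dvd_add hp hq using 1
    rw [derivative_add]
    ring
  | monomial i c =>
    rw [← C_mul_X_pow_eq_monomial, map_mul (expand K 2), map_pow (expand K 2), expand_C, expand_X]
    have key : X ^ N ∣ D ((X ^ 2) ^ i * w) -
        ((X ^ 2) ^ i * D w + derivative ((X ^ 2) ^ i) * h * w) := by
      induction i with
      | zero => simp
      | succ i ih =>
        convert dvd_add (hD ((X ^ 2) ^ i * w)) (ih.mul_right (X ^ 2)) using 1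
        rw [pow_succ, show (X ^ 2) ^ i * X ^ 2 * w = (X ^ 2) ^ i * w * (X : K[X]) ^ 2 by ring,
          derivative_mul, derivative_X_pow, Nat.cast_ofNat, C_ofNat]
        ring
    convert key.mul_left (C c) using 1
    rw [derivative_C_mul, mul_assoc (C c), ← smul_eq_C_mul, map_smul, smul_eq_C_mul]
    ring

variable {f g : K[X]}

/-- Suppose that `D` satisfies the product rule for multiplication by `X²` and by `X f`. Splitting
`f` into even and odd parts, `D` is determined by `D 1` and `D X`, and the product rule for `X f`
applied to `1` and to `X` gives two conditions on them. -/
theorem dvd_of_leibniz_X_sq_of_leibniz_X_mul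
    (hX : ∀ p, X ^ N ∣ D (p * X ^ 2) - (D p * X ^ 2 + 2 * p * X * h))
    (hf : ∀ p, X ^ N ∣ D (p * X * f) - (D p * X * f + p * h * f + p * X * g)) :
    X ^ N ∣ 2 * (X * (expand K 2 (contract 2 f) * (D X - X * D 1 - h))) ∧
    X ^ N ∣ X * (h * derivative f - g) +
      expand K 2 (contract 2 f) * (D X - X * D 1 - h) := by
  have hfe := expand_contract_two_add f
  generalize contract 2 f = R at *
  generalize contract 2 f.divX = Q at *
  have a1 := dvd_map_expand_mul_sub hX R X
  have a2 := dvd_map_expand_mul_sub hX (X * R) 1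
  have b1 := dvd_map_expand_mul_sub hX (X * Q) 1
  have b2 := dvd_map_expand_mul_sub hX (X * Q) X
  have f1 := hf 1
  have f2 := hf X
  simp only [map_mul (expand K 2), expand_X, derivative_mul, derivative_X_pow] at a1 a2 b1 b2
  generalize expand K 2 R = A at *
  generalize expand K 2 Q = B at *
  have e1 : 1 * X * f = A * X + X ^ 2 * B * 1 := by rw [← hfe]; ring
  have e2 : X * X * f = X ^ 2 * A * 1 + X ^ 2 * B * X := by rw [← hfe]; ring
  rw [e1, map_add] at f1
  rw [e2, map_add] at f2
  have hdf : derivative f = derivative A + (B + X * derivative B) := by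
    rw [← hfe, derivative_add, derivative_mul, derivative_X, one_mul]
  obtain ⟨c1, hc1⟩ := dvd_sub (dvd_sub f1 a1) b1
  obtain ⟨c2, hc2⟩ := dvd_sub (dvd_sub f2 a2) b2
  simp only [Nat.cast_ofNat, C_ofNat] at hc1 hc2
  refine ⟨⟨X * c1 - c2, ?_⟩, ⟨c1, ?_⟩⟩
  · linear_combination X * hc1 - hc2 + (D X * X - D 1 * X ^ 2) * hfe
  · rw [hdf]
    linear_combination hc1 - (D 1 * X + h) * hfe

end EvenOdd

namespace LeibnizAlgebra

variable {K L : Type*} [Field K] [AddCommGroup L] [Module K L] {n : ℕ}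
  {b : Module.Basis (Fin n) K L} {α : ℕ → K} {θ : K}

theorem rightPoly_ofPoly_X_mul (hn : 2 ≤ n) (f q : K[X]) :
    rightPoly b f (ofPoly b (X * q)) = 0 := by
  have h0 := coeff_zero_toPoly b (ofPoly b (X * q))
  have h1 := X_pow_dvd_iff.1 (dvd_toPoly_ofPoly_sub b (X * q)) 0 (by omega)
  rw [coeff_sub, h0, fstCoord_ofPoly] at h1
  simp at h1
  simp [rightPoly, fstCoord_ofPoly, h1]

/-- The filtration of `L` by the images of the ideals generated by the powers of `X` shows
nilpotency. -/
theorem isNilpotent_of_raises_degree {P : Module.End K L}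
    (hfst : ∀ v, fstCoord b (P v) = 0) (hsnd : ∀ v, sndCoord b (P v) = 0)
    (hdeg : ∀ i, X ^ min (i + 1) (n - 1) ∣ toPoly b (P (ofPoly b (X ^ i)))) :
    IsNilpotent P := by
  have hP : ∀ v, ofPoly b (toPoly b (P v)) = P v := fun v => by
    have := ofPoly_toPoly_add b (P v)
    rwa [hfst, zero_smul, add_zero] at this
  have hdeg' : ∀ i (q : K[X]), X ^ min (i + 1) (n - 1) ∣ toPoly b (P (ofPoly b (X ^ i * q))) := by
    intro i q
    induction q using Polynomial.induction_on' with
    | add p q hp hq =>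
      rw [mul_add, map_add, map_add, map_add]
      exact dvd_add hp hq
    | monomial j c =>
      rw [← C_mul_X_pow_eq_monomial, mul_left_comm, ofPoly_C_mul, map_smul, map_smul,
        smul_eq_C_mul, ← pow_add]
      exact ((pow_dvd_pow _ (by omega)).trans (hdeg (i + j))).mul_left _
  have key : ∀ j v, ∃ q, X ^ min (j + 1) (n - 1) ∣ q ∧ (P ^ (j + 1)) v = ofPoly b q := by
    intro j v
    induction j with
    | zero =>
      refine ⟨toPoly b (P v), (pow_dvd_pow _ (min_le_left _ _)).trans ?_, ?_⟩
      · rw [zero_add, pow_one, X_dvd_iff, coeff_zero_toPoly, hfst, hsnd, add_zero]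
      · rw [hP, zero_add, pow_one]
    | succ j ih =>
      obtain ⟨q, ⟨q', rfl⟩, hq⟩ := ih
      refine ⟨_, (pow_dvd_pow _ (by omega)).trans (hdeg' (min (j + 1) (n - 1)) q'), ?_⟩
      rw [pow_succ', Module.End.mul_apply, hq, hP]
  refine ⟨n + 1, LinearMap.ext fun v => ?_⟩
  obtain ⟨q, hq, hv⟩ := key n v
  rw [hv, LinearMap.zero_apply]
  exact ofPoly_eq_zero_of_dvd b ((pow_dvd_pow _ (by omega)).trans hq)

variable [LeibnizAlgebra K L]

/-- A pre-derivation induces an operator on polynomials with a product rule modulo `X ^ (n - 1)`.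
-/
theorem IsF1Basis.dvd_of_isPreDerivation (hb : IsF1Basis α θ b) (hn : 4 ≤ n) {P : Module.End K L}
    (hP : IsPreDerivation K P) {f : K[X]} (hf : structurePoly n α = f) (p : K[X]) (w z : L) :
    X ^ (n - 1) ∣ toPoly b (P (ofPoly b (p * rightPoly b f w * rightPoly b f z))) -
      (toPoly b (P (ofPoly b p)) * rightPoly b f w * rightPoly b f z +
        p * rightPoly b f (P w) * rightPoly b f z +
        p * rightPoly b f w * rightPoly b f (P z)) := by
  have h := (hb.isPreDerivation_iff hn hf).1 hP (ofPoly b p) w z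
  have h0 := dvd_toPoly_ofPoly_sub b p
  have h1 : ofPoly b (toPoly b (ofPoly b p) * rightPoly b f w * rightPoly b f z) =
      ofPoly b (p * rightPoly b f w * rightPoly b f z) := by
    apply ofPoly_congr
    rw [← sub_mul, ← sub_mul]
    exact (h0.mul_right _).mul_right _
  rw [h1] at h
  rw [h]
  refine (dvd_add (dvd_toPoly_ofPoly_sub b (toPoly b (P (ofPoly b p)) * rightPoly b f w *
    rightPoly b f z + toPoly b (ofPoly b p) * rightPoly b f (P w) * rightPoly b f z +
    toPoly b (ofPoly b p) * rightPoly b f w * rightPoly b f (P z))) (h0.mul_right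
    (rightPoly b f (P w) * rightPoly b f z + rightPoly b f w * rightPoly b f (P z)))).trans ?_
  apply dvd_of_eq
  ring

/-- If the even part of `f` is nonzero modulo `X ^ (n - 3)`, a non-nilpotent pre-derivation forces
the differential equation on `f`. It comes out for `f` with the coordinates `h₁` of `P e₁` and
`g₂` of `P e₂` as coefficients; comparing lowest terms gives `g₂ = k h₁`, and `h₁ = 0` would make
`P` nilpotent. -/
theorem IsF1Basis.exists_ode [CharZero K] (hb : IsF1Basis α θ b) {s : ℕ} (hs : 2 ≤ s)
    (hsn : 2 * s ≤ n - 2) {f : K[X]} (hf : structurePoly n α = f)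
    (hα : α (2 * s) ≠ 0) (hmin : ∀ i, 2 ≤ i → i < s → α (2 * i) = 0)
    (hL : ¬ IsStronglyNilpotent K L) :
    ∃ k, 2 ≤ k ∧ k ≤ n - 4 ∧ f.coeff k ≠ 0 ∧ (∀ i < k, f.coeff i = 0) ∧
      X ^ (n - 3) ∣ (X + C ((k : K) - 1) * f) * derivative f - C (k : K) * f := by
  have hn : 6 ≤ n := by omega
  simp only [IsStronglyNilpotent, not_forall] at hL
  obtain ⟨P, hP, hPn⟩ := hL
  have hX2f : X ^ 2 ∣ f := hf ▸ X_sq_dvd_structurePoly α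
  have hXf' : X ∣ derivative f := by
    simpa using X_pow_dvd_derivative (M := 1) hX2f
  have hXf : X ∣ f := hf ▸ X_dvd_structurePoly α
  have hfs : f.coeff (2 * s - 2) = α (2 * s) := by
    rw [← hf, coeff_structurePoly, if_pos (by omega), show 2 * s - 2 + 2 = 2 * s by omega]
  have hr1 := rightPoly_one b (by omega) f
  have hr2 := rightPoly_two b (by omega) f
  -- The first two coordinates of the image of `e₁ - e₂` are opposite, since `[e₁ - e₂, e₁] = 0`.
  have hu : fstCoord b (P (basisVec b 1)) + sndCoord b (P (basisVec b 1)) =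
      fstCoord b (P (basisVec b 2)) + sndCoord b (P (basisVec b 2)) := by
    have h := (hb.isPreDerivation_iff (by omega) hf).1 hP (basisVec b 1 - basisVec b 2)
      (basisVec b 1) (basisVec b 1)
    rw [toPoly_basisVec_one_sub b (by omega), hr1] at h
    simp only [zero_mul, map_zero, add_zero] at h
    have h2 := X_pow_dvd_iff.1 ((ofPoly_eq_zero_iff b).1 h.symm) 2 (by omega)
    rw [show (2 : ℕ) = 0 + 1 + 1 by rfl, coeff_mul_X, coeff_mul_X, coeff_zero_toPoly, map_sub,
      map_sub, map_sub] at h2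
    linear_combination h2
  -- `P` preserves the span of `e₃, …, eₙ`.
  have hsq : ∀ q, fstCoord b (P (ofPoly b (X * q))) = 0 ∧
      sndCoord b (P (ofPoly b (X * q))) = 0 := by
    intro q
    have h := (hb.isPreDerivation_iff (by omega) hf).1 hP (basisVec b 2) (ofPoly b (X * q))
      (basisVec b 1)
    rw [rightPoly_ofPoly_X_mul (by omega), toPoly_basisVec b (by omega) (by omega), hr1] at h
    simp only [zero_mul, mul_zero, map_zero, add_zero, zero_add, Nat.sub_self, pow_zero,
      one_mul] at h
    have h' := X_pow_dvd_iff.1 ((ofPoly_eq_zero_iff b).1 h.symm)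
    have h1 := h' 2 (by omega)
    have h2 := h' (2 * s - 2 + 1) (by omega)
    rw [coeff_mul_X, rightPoly, coeff_add, coeff_C_mul, coeff_C_mul] at h1 h2
    have hc : f.coeff 1 = 0 := X_pow_dvd_iff.1 hX2f 1 (by omega)
    rw [coeff_X_one, hc, mul_zero, add_zero, _root_.mul_one] at h1
    rw [h1, zero_mul, zero_add, hfs, mul_eq_zero, or_iff_left hα] at h2
    exact ⟨h1, h2⟩
  set D : K[X] →ₗ[K] K[X] := toPoly b ∘ₗ P ∘ₗ ofPoly b with hD
  have hDa : ∀ q, toPoly b (P (ofPoly b q)) = D q := fun q => rfl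
  set h := rightPoly b f (P (basisVec b 1)) with hh
  set g := rightPoly b f (P (basisVec b 2)) with hg
  have hDX : ∀ p, X ^ (n - 1) ∣ D (p * X ^ 2) - (D p * X ^ 2 + 2 * p * X * h) := by
    intro p
    have := hb.dvd_of_isPreDerivation (by omega) hP hf p (basisVec b 1) (basisVec b 1)
    rw [hr1, ← hh, hDa, hDa] at this
    convert this using 1
    rw [mul_assoc p, ← pow_two]
    ring
  have hDf : ∀ p, X ^ (n - 1) ∣ D (p * X * f) - (D p * X * f + p * h * f + p * X * g) := by
    intro p
    have := hb.dvd_of_isPreDerivation (by omega) hP hf p (basisVec b 1) (basisVec b 2)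
    rwa [hr1, hr2, ← hh, ← hg, hDa, hDa] at this
  obtain ⟨k1, k2⟩ := dvd_of_leibniz_X_sq_of_leibniz_X_mul hDX hDf
  set A := expand K 2 (contract 2 f) with hA
  set m := D X - X * D 1 - h with hm
  have hAm : X ^ (n - 2) ∣ A * m := by
    rw [show (2 : K[X]) = C 2 by rw [C_ofNat], IsUnit.dvd_mul_left (by simp),
      show n - 1 = n - 2 + 1 by omega, pow_succ'] at k1
    exact (mul_dvd_mul_iff_left X_ne_zero).1 k1
  have hode : X ^ (n - 3) ∣ h * derivative f - g := by
    have := dvd_sub ((pow_dvd_pow X (show n - 2 ≤ n - 1 by omega)).trans k2) hAm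
    rw [add_sub_cancel_right, show n - 2 = n - 3 + 1 by omega, pow_succ'] at this
    exact (mul_dvd_mul_iff_left X_ne_zero).1 this
  have hDX0 : (D X).coeff 0 = 0 := by
    have := hsq 1
    rw [_root_.mul_one] at this
    rw [← hDa, coeff_zero_toPoly, this.1, this.2, add_zero]
  have hXh : X ∣ h := by
    rw [hh, ← hf]
    exact X_dvd_rightPoly _
  have hXm : X ∣ m := by
    rw [X_dvd_iff, hm, coeff_sub, coeff_sub, hDX0, X_dvd_iff.1 hXh]
    simp
  -- The lowest term of the even part `A` is `α (2 s) X ^ (2 s - 2)`, and `2 s - 1 < n - 2`.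
  have hm1 : m.coeff 1 = 0 := by
    have hAs : X ^ (2 * s - 2) ∣ A := by
      refine X_pow_dvd_iff.2 fun i hi => ?_
      rw [hA, coeff_expand two_pos]
      split_ifs with hi2
      · obtain ⟨j, rfl⟩ := hi2
        rw [Nat.mul_div_cancel_left _ two_pos, coeff_contract two_ne_zero, ← hf,
          coeff_structurePoly]
        split_ifs with hj
        · rw [show j * 2 + 2 = 2 * (j + 1) by ring]
          exact hmin _ (by omega) (by omega)
        · rfl
      · rfl
    have hA0 : A.coeff (2 * s - 2) = α (2 * s) := by
      rw [hA, show 2 * s - 2 = 2 * (s - 1) by omega, coeff_expand_mul' two_pos,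
        coeff_contract two_ne_zero, ← hfs]
      congr 1; omega
    obtain ⟨A', hA'⟩ := hAs
    obtain ⟨m', hm'⟩ := hXm
    have := X_pow_dvd_iff.1 hAm (0 + (2 * s - 2 + 1)) (by omega)
    rw [hA', hm', show X ^ (2 * s - 2) * A' * (X * m') = A' * m' * X ^ (2 * s - 2 + 1) by ring,
      coeff_mul_X_pow, mul_coeff_zero] at this
    rw [hA', coeff_X_pow_mul', if_pos le_rfl, Nat.sub_self] at hA0
    rw [hA0, mul_eq_zero, or_iff_right hα] at this
    rw [hm', show 1 = 0 + 1 by rfl, coeff_X_mul, this]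
  rw [rightPoly] at hh hg
  set h1 := fstCoord b (P (basisVec b 1)) with hh1
  set h2 := sndCoord b (P (basisVec b 1)) with hh2
  set g1 := fstCoord b (P (basisVec b 2)) with hg1
  set g2 := sndCoord b (P (basisVec b 2)) with hg2
  have hg10 : g1 = 0 := by
    have hhf : X ^ 2 ∣ h * derivative f := by rw [pow_two]; exact mul_dvd_mul hXh hXf'
    have e1 := X_pow_dvd_iff.1 hode 1 (by omega)
    rw [coeff_sub, X_pow_dvd_iff.1 hhf 1 (by omega), hg, coeff_add, coeff_C_mul, coeff_C_mul,
      X_pow_dvd_iff.1 hX2f 1 (by omega)] at e1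
    simpa using e1
  obtain ⟨k, hk, hkmin⟩ : ∃ k, f.coeff k ≠ 0 ∧ ∀ i < k, f.coeff i = 0 := by
    classical
    have hex : ∃ k, f.coeff k ≠ 0 := ⟨2 * s - 2, by rwa [hfs]⟩
    exact ⟨Nat.find hex, Nat.find_spec hex, fun i hi => not_not.1 (Nat.find_min hex hi)⟩
  have hk2 : 2 ≤ k := by
    by_contra hlt
    exact hk (X_pow_dvd_iff.1 hX2f k (by omega))
  have hkn : k ≤ n - 4 := by
    by_contra hlt
    exact hα (hfs ▸ hkmin (2 * s - 2) (by omega))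
  have hh2' : h2 = g2 - h1 := by rw [hg10, zero_add] at hu; linear_combination hu
  have hr : h * derivative f - g =
      C h1 * (X * derivative f) + C (g2 - h1) * (f * derivative f) - C g2 * f := by
    rw [hh, hg, hg10, hh2']
    simp only [map_zero]
    ring
  have hg2k : g2 = h1 * k := by
    have hff : X ^ (k + 1) ∣ f * derivative f := by
      rw [pow_succ]
      exact mul_dvd_mul (X_pow_dvd_iff.2 hkmin) hXf'
    have e1 := X_pow_dvd_iff.1 hode k (by omega)
    have e2 : (X * derivative f).coeff k = f.coeff k * k := by
      obtain ⟨j, rfl⟩ : ∃ j, k = j + 1 := ⟨k - 1, by omega⟩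
      rw [coeff_X_mul, coeff_derivative]
      push_cast
      ring
    rw [hr, coeff_sub, coeff_add, coeff_C_mul, coeff_C_mul, coeff_C_mul,
      X_pow_dvd_iff.1 hff k (by omega), e2] at e1
    have : f.coeff k * (h1 * k - g2) = 0 := by linear_combination e1
    rw [mul_eq_zero, or_iff_right hk] at this
    linear_combination -this
  refine ⟨k, hk2, hkn, hk, hkmin, ?_⟩
  by_cases hh10 : h1 = 0
  · have hg20 : g2 = 0 := by rw [hg2k, hh10, zero_mul]
    have hh20 : h2 = 0 := by rw [hh2', hg20, hh10, sub_zero]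
    have hh0 : h = 0 := by rw [hh, hh10, hh20]; simp
    have hdec : ∀ v : L, v = ofPoly b (X * (toPoly b v).divX) +
        (toPoly b v).coeff 0 • basisVec b 2 +
        fstCoord b v • (basisVec b 1 - basisVec b 2) := by
      intro v
      have e := ofPoly_toPoly_add b v
      rw [← X_mul_divX_add (toPoly b v), map_add, ← _root_.mul_one (C _), ofPoly_C_mul,
        ← pow_zero X, ofPoly_X_pow] at e
      exact e.symm
    refine absurd (isNilpotent_of_raises_degree (b := b) (P := P) ?_ ?_ ?_) hPn
    · intro v
      rw [hdec v, map_add, map_add, map_smul, map_smul, map_sub, map_add, map_add, map_smul,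
        map_smul, map_sub, (hsq _).1, ← hh1, ← hg1, hg10, hh10]
      simp
    · intro v
      rw [hdec v, map_add, map_add, map_smul, map_smul, map_sub, map_add, map_add, map_smul,
        map_smul, map_sub, (hsq _).2, ← hh2, ← hg2, hg20, hh20]
      simp
    · have hD1 : (D 1).coeff 0 = 0 := by
        rw [← hDa, ← pow_zero X, ofPoly_X_pow, zero_add, coeff_zero_toPoly, ← hg1, ← hg2, hg10,
          hg20, add_zero]
      have hDX1 : (D X).coeff 1 = 0 := by
        rw [hm, hh0, sub_zero, coeff_sub, show 1 = 0 + 1 by rfl, coeff_X_mul, hD1,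
          sub_zero] at hm1
        exact hm1
      intro i
      rw [hDa]
      induction i using Nat.twoStepInduction with
      | zero =>
        refine (pow_dvd_pow _ (min_le_left _ _)).trans (X_pow_dvd_iff.2 fun d hd => ?_)
        obtain rfl : d = 0 := by omega
        rw [pow_zero, hD1]
      | one =>
        refine (pow_dvd_pow _ (min_le_left _ _)).trans (X_pow_dvd_iff.2 fun d hd => ?_)
        rw [pow_one]
        obtain rfl | rfl : d = 0 ∨ d = 1 := by omega
        · exact hDX0
        · exact hDX1
      | more i ih _ =>
        have e := (pow_dvd_pow X (min_le_right (i + 2 + 1) (n - 1))).trans (hDX (X ^ i))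
        rw [hh0, mul_zero, add_zero, ← pow_add] at e
        have e' : X ^ min (i + 2 + 1) (n - 1) ∣ D (X ^ i) * X ^ 2 := by
          refine (pow_dvd_pow X (show _ ≤ min (i + 1) (n - 1) + 2 by omega)).trans ?_
          rw [pow_add]
          exact mul_dvd_mul_right ih _
        simpa using dvd_add e e'
  · have e : h * derivative f - g =
        C h1 * ((X + C ((k : K) - 1) * f) * derivative f - C (k : K) * f) := by
      rw [hr, hg2k]
      simp only [map_sub, map_mul, map_one]
      ring
    rw [e, IsUnit.dvd_mul_left (by simpa using hh10)] at hode
    exact hode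

end LeibnizAlgebra

/-! ### The classification -/

namespace LeibnizAlgebra

variable {K L : Type*} [Field K] [AddCommGroup L] [Module K L] {n : ℕ}
  {b : Module.Basis (Fin n) K L} {α : ℕ → K} {θ : K}

theorem pCatalan_one {k : ℕ} (hk : 1 ≤ k) : pCatalan k 1 = 1 := by
  have : (k : ℚ) ≠ 0 := by exact_mod_cast (by omega : k ≠ 0)
  simp [pCatalan, this]

theorem coeff_eq_zero_of_lt_of_catalan {k N : ℕ} {F : K[X]}
    (hF : ∀ i, i < N → (∀ t, 1 ≤ t → i ≠ (k - 1) * t + 1) → F.coeff i = 0) {i : ℕ}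
    (hi : i < k) (hiN : i < N) : F.coeff i = 0 := by
  refine hF i hiN fun t ht h => ?_
  have := Nat.le_mul_of_pos_right (k - 1) ht
  omega

variable [CharZero K]

/-- Solutions `f` of the differential equation of order at least `k` have Fuss–Catalan
coefficients. The coefficient of degree `i` of `f` is `α (i + 2)`. -/
theorem catalan_of_ode {k : ℕ} (hk : 2 ≤ k) (hkn : k ≤ n - 4)
    {f : K[X]} (hf : structurePoly n α = f) (hlow : ∀ i < k, f.coeff i = 0)
    (hode : X ^ (n - 3) ∣ (X + C ((k : K) - 1) * f) * derivative f - C (k : K) * f) :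
    (∀ t, 1 ≤ t → (k - 1) * t + 3 ≤ n - 2 →
      α ((k - 1) * t + 3) = (-1) ^ (t + 1) * ((pCatalan k t : ℚ) : K) * α (k + 2) ^ t) ∧
    (∀ j, 4 ≤ j → j ≤ n - 2 → (∀ t, 1 ≤ t → j ≠ (k - 1) * t + 3) → α j = 0) := by
  obtain ⟨F, hF1, hF2, hF⟩ := exists_catalan_solution hk (α (k + 2)) (n - 3)
  have hFlow : ∀ i < k, F.coeff i = 0 := fun i hi =>
    coeff_eq_zero_of_lt_of_catalan hF2 hi (by omega)
  have hcoeff : ∀ i, 2 ≤ i → i + 2 ≤ n → f.coeff i = α (i + 2) := fun i h2 hi => by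
    rw [← hf, coeff_structurePoly, if_pos ⟨h2, hi⟩]
  have hFk : F.coeff k = α (k + 2) := by
    have := hF1 1 le_rfl (by omega)
    rwa [pCatalan_one (by omega), mul_one, show k - 1 + 1 = k by omega, Rat.cast_one, pow_one,
      one_add_one_eq_two, neg_one_sq, one_mul, one_mul] at this
  have heq := coeff_eq_of_ode (hf ▸ X_sq_dvd_structurePoly α)
    (X_pow_dvd_iff.2 fun d hd => hFlow d (by omega)) hode hF fun i hi => by
      rcases hi.lt_or_eq with h | rfl
      · rw [hlow i h, hFlow i h]
      · rw [hFk, hcoeff _ hk (by omega)]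
  constructor
  · intro t ht htn
    have : 0 < (k - 1) * t := Nat.mul_pos (by omega) ht
    rw [← hF1 t ht (by omega), ← heq _ (by omega), hcoeff _ (by omega) (by omega)]
  · intro j hj4 hj hjt
    obtain ⟨i, rfl⟩ : ∃ i, j = i + 2 := ⟨j - 2, by omega⟩
    rw [← hcoeff i (by omega) (by omega), heq i (by omega)]
    exact hF2 i (by omega) fun t ht h => hjt t ht (by omega)

/-- The converse of `catalan_of_ode`. Replacing `f` by a solution that agrees with it below degree
`n - 3` loses nothing, as the factor `X + (k - 1) f` of `f'` is divisible by `X`. -/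
theorem ode_of_catalan {k : ℕ} (hk : 2 ≤ k)
    {f : K[X]} (hf : structurePoly n α = f)
    (h1 : ∀ t, 1 ≤ t → (k - 1) * t + 3 ≤ n - 2 →
      α ((k - 1) * t + 3) = (-1) ^ (t + 1) * ((pCatalan k t : ℚ) : K) * α (k + 2) ^ t)
    (h2 : ∀ j, 4 ≤ j → j ≤ n - 2 → (∀ t, 1 ≤ t → j ≠ (k - 1) * t + 3) → α j = 0) :
    (∀ i < k, i < n - 3 → f.coeff i = 0) ∧
      X ^ (n - 3) ∣ (X + C ((k : K) - 1) * f) * derivative f - C (k : K) * f := by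
  obtain ⟨F, hF1, hF2, hF⟩ := exists_catalan_solution hk (α (k + 2)) (n - 3)
  have heq : ∀ i < n - 3, f.coeff i = F.coeff i := by
    intro i hi
    rw [← hf, coeff_structurePoly]
    by_cases hit : ∃ t, 1 ≤ t ∧ i = (k - 1) * t + 1
    · obtain ⟨t, ht, rfl⟩ := hit
      have : 0 < (k - 1) * t := Nat.mul_pos (by omega) ht
      rw [hF1 t ht hi, if_pos (by omega)]
      exact h1 t ht (by omega)
    · push Not at hit
      rw [hF2 i hi hit]
      split_ifs with h
      · exact h2 _ (by omega) (by omega) fun t ht h' => hit t ht (by omega)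
      · rfl
  refine ⟨fun i hik hi => (heq i hi).trans (coeff_eq_zero_of_lt_of_catalan hF2 hik hi), ?_⟩
  have hX : X ∣ X + C ((k : K) - 1) * f :=
    dvd_add dvd_rfl ((hf ▸ X_dvd_structurePoly α : X ∣ f).mul_left _)
  have hsub : X ^ (n - 3) ∣ f - F :=
    X_pow_dvd_iff.2 fun d hd => by rw [coeff_sub, heq d hd, sub_self]
  have hder : X ^ (n - 3) ∣ (X + C ((k : K) - 1) * f) * derivative (f - F) := by
    rcases Nat.eq_zero_or_pos (n - 3) with h | h
    · simp [h]
    · obtain ⟨m, hm⟩ : ∃ m, n - 3 = m + 1 := ⟨n - 4, by omega⟩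
      rw [hm] at hsub ⊢
      rw [pow_succ']
      exact mul_dvd_mul hX (X_pow_dvd_derivative hsub)
  have e : (X + C ((k : K) - 1) * f) * derivative f - C (k : K) * f =
      (X + C ((k : K) - 1) * F) * derivative F - C (k : K) * F +
      (X + C ((k : K) - 1) * f) * derivative (f - F) +
      (C ((k : K) - 1) * derivative F - C (k : K)) * (f - F) := by
    rw [derivative_sub]; ring
  rw [e]
  exact dvd_add (dvd_add hF hder) (hsub.mul_left _)

variable [LeibnizAlgebra K L]

/-- Cases (i) and (ii) of the classification become one, for `s = 2` and `s ≥ 3`, once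
`α (2 s) ≠ 0` is required; when `α (2 s) = 0` in (ii), case (iii) holds. -/
theorem IsF1Basis.not_isStronglyNilpotent_iff (hb : IsF1Basis α θ b) (hn : 4 ≤ n)
    (hev : Even n) :
    ¬ IsStronglyNilpotent K L ↔
      (∃ s, 2 ≤ s ∧ s ≤ (n - 2) / 2 ∧ α (2 * s) ≠ 0 ∧
        (∀ t, 1 ≤ t → (2 * s - 3) * t + 3 ≤ n - 2 → α ((2 * s - 3) * t + 3) =
          (-1) ^ (t + 1) * ((pCatalan (2 * s - 2) t : ℚ) : K) * α (2 * s) ^ t) ∧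
        (∀ j, 4 ≤ j → j ≤ n - 2 → (∀ t, 1 ≤ t → j ≠ (2 * s - 3) * t + 3) → α j = 0)) ∨
      (∀ i, 2 ≤ i → i ≤ (n - 2) / 2 → α (2 * i) = 0) := by
  constructor
  · intro hL
    rw [or_iff_not_imp_right]
    intro h
    push Not at h
    classical
    obtain ⟨hs2, hsn, hs⟩ := Nat.find_spec h
    have hmin := fun i => Nat.find_min h (m := i)
    set s := Nat.find h
    obtain ⟨k, hk2, hkn, hk, hlow, hode⟩ := hb.exists_ode (f := structurePoly n α) hs2 (by omega)
      rfl hs (fun i hi his => by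
        by_contra hne
        exact hmin i his ⟨hi, by omega, hne⟩) hL
    have hcat := catalan_of_ode hk2 hkn rfl hlow hode
    rw [coeff_structurePoly, if_pos (by omega)] at hk
    -- For odd `k` all indices `(k - 1) t + 3` are odd, which would force `α (2 s) = 0`.
    have hke : Even k := by
      by_contra hko
      refine hs (hcat.2 _ (by omega) (by omega) fun t ht h' => ?_)
      obtain ⟨m, rfl⟩ := Nat.not_even_iff_odd.1 hko
      rw [Nat.add_sub_cancel, mul_assoc] at h'
      omega
    obtain ⟨m, rfl⟩ := hke
    refine ⟨m + 1, by omega, by omega, ?_⟩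
    rw [show 2 * (m + 1) - 3 = m + m - 1 by omega, show 2 * (m + 1) - 2 = m + m by omega,
      show 2 * (m + 1) = m + m + 2 by ring]
    exact ⟨hk, hcat.1, hcat.2⟩
  · rintro (⟨s, hs2, hsn, hs, h1, h2⟩ | h)
    · obtain ⟨k, hk⟩ : ∃ k, 2 * s = k + 2 := ⟨2 * s - 2, by omega⟩
      have hsk : 2 * s - 2 = k := by omega
      have hode := ode_of_catalan (n := n) (α := α) (k := k) (by omega) rfl
        (by rw [← hk, ← hsk]; exact h1)
        (by rw [← hsk]; exact h2)
      refine hb.not_isStronglyNilpotent_of_ode hs2 (by omega) _ rfl hs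
        (fun i hi => hode.1 i (by omega) (by omega)) ?_
      rw [hsk]
      exact hode.2
    · exact hb.not_isStronglyNilpotent_of_even hn hev h

end LeibnizAlgebra

theorem theorem4p2 (n : ℕ) (hn4 : 4 ≤ n) (hn : Even n) (α : ℕ → ℂ) (θ : ℂ)
    (L : Type*) [AddCommGroup L] [Module ℂ L] [LeibnizAlgebra ℂ L]
    (hL : LeibnizAlgebra.IsF1 L n α θ) :
    ¬ LeibnizAlgebra.IsStronglyNilpotent ℂ L ↔
      (α 4 ≠ 0 ∧ ∀ k, 5 ≤ k → k ≤ n - 2 →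
        α k = (-1) ^ k * (pCatalan 2 (k - 3) : ℂ) * α 4 ^ (k - 3)) ∨
      (∃ s, 3 ≤ s ∧ s ≤ (n - 2) / 2 ∧
        (∀ t, 1 ≤ t → t ≤ (n - 5) / (2 * s - 3) →
          α ((2 * s - 3) * t + 3) =
            (-1) ^ (t + 1) * (pCatalan (2 * s - 2) t : ℂ) * α (2 * s) ^ t) ∧
        (∀ j, 4 ≤ j → j ≤ n - 2 → (∀ t, 1 ≤ t → j ≠ (2 * s - 3) * t + 3) → α j = 0)) ∨
      (∀ i, 2 ≤ i → i ≤ (n - 2) / 2 → α (2 * i) = 0) := by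
  obtain ⟨b, hb⟩ := hL
  rw [hb.not_isStronglyNilpotent_iff hn4 hn]
  have hrange : ∀ s t, 3 ≤ s → s ≤ (n - 2) / 2 →
      (t ≤ (n - 5) / (2 * s - 3) ↔ (2 * s - 3) * t + 3 ≤ n - 2) := fun s t hs hsn => by
    rw [Nat.le_div_iff_mul_le (by omega), mul_comm]
    omega
  constructor
  · rintro (⟨s, hs2, hsn, hs, h1, h2⟩ | h)
    · rcases hs2.eq_or_lt with rfl | hs3
      · refine Or.inl ⟨hs, fun k hk hkn => ?_⟩
        have := h1 (k - 3) (by omega) (by omega)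
        rwa [show (2 * 2 - 3) * (k - 3) + 3 = k by omega,
          show (-1 : ℂ) ^ (k - 3 + 1) = (-1) ^ k by
            conv_rhs => rw [show k = k - 3 + 1 + 2 by omega, pow_add, neg_one_sq, mul_one]]
          at this
      · exact Or.inr (Or.inl ⟨s, hs3, hsn,
          fun t ht htn => h1 t ht ((hrange s t hs3 hsn).1 htn), h2⟩)
    · exact Or.inr (Or.inr h)
  · rintro (⟨h4, h⟩ | ⟨s, hs3, hsn, h1, h2⟩ | h)
    · rcases hn4.eq_or_lt with rfl | hn5
      · exact Or.inr fun i hi hi' => by omega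
      · obtain ⟨m, rfl⟩ := hn
        refine Or.inl ⟨2, le_rfl, by omega, h4, fun t ht htn => ?_, fun j hj hjn hjt => ?_⟩
        · rcases ht.eq_or_lt with rfl | ht2
          · simp [LeibnizAlgebra.pCatalan_one]
          · have := h (t + 3) (by omega) (by omega)
            rw [show (2 * 2 - 3) * t + 3 = t + 3 by omega, this, Nat.add_sub_cancel,
              show (-1 : ℂ) ^ (t + 3) = (-1) ^ (t + 1) by
                rw [show t + 3 = t + 1 + 2 by omega, pow_add, neg_one_sq, mul_one]]
        · exact absurd (by omega) (hjt (j - 3) (by omega))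
    · by_cases hs : α (2 * s) = 0
      · -- All coefficients up to `n - 2` vanish, so the even ones do.
        refine Or.inr fun i hi hin => ?_
        by_cases hit : ∃ t, 1 ≤ t ∧ 2 * i = (2 * s - 3) * t + 3
        · obtain ⟨t, ht, hti⟩ := hit
          rw [hti, h1 t ht ((hrange s t hs3 hsn).2 (by omega)), hs, zero_pow (by omega), mul_zero]
        · push Not at hit
          exact h2 _ (by omega) (by omega) hit
      · exact Or.inl ⟨s, by omega, hsn, hs,
          fun t ht htn => h1 t ht ((hrange s t hs3 hsn).2 htn), h2⟩
    · exact Or.inr h
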